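/- Let $A$ be a real algebra (a real vector space with a bilinear product, not assumed associative, commutative or unital) of dimension $4$ which is absolute-valued, i.e. endowed with a norm $\|\cdot\|$ satisfying $\|xy\|=\|x\|\,\|y\|$ for all $x,y\in A$. Write $(x,y,z)=(xy)z-x(yz)$ and $x^2=xx$. Then the following are equivalent: 1. $A$ is flexible, i.e. $(x,y,x)=0$ for all $x,y\in A$; 2. $A$ is third power-associative, i.e. $(x,x,x)=0$ for all $x\in A$; 3. $(x,x^2,x)=0$ for all $x\in A$; 4. $A$ is isomorphic, as a real algebra, to the quaternion algebra $\mathbb{H}$ or to $\overset{*}{\mathbb{H}}$, the real vector space $\mathbb{H}$ endowed with the product $x\odot y=\overline{x}\,\overline{y}$, where $x\mapsto\overline{x}$ is the standard conjugation of $\mathbb{H}$. -/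

import Mathlib

open scoped Quaternion

/-- A (vector space) norm `ν` on a real algebra `A`, not necessarily associative, commutative or
unital, is an absolute value if it is definite and satisfies `ν (x * y) = ν x * ν y`. -/
structure IsAbsoluteValuedNorm {A : Type*} [NonUnitalNonAssocRing A] [Module ℝ A]
    (ν : Seminorm ℝ A) : Prop where
  eq_zero_of_map_eq_zero : ∀ x : A, ν x = 0 → x = 0
  map_mul : ∀ x y : A, ν (x * y) = ν x * ν y

/-- `A` is flexible: `(x, y, x) = 0` for all `x, y`. -/
def IsFlexibleAlgebra (A : Type*) [NonUnitalNonAssocRing A] : Prop :=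
  ∀ x y : A, associator x y x = 0

/-- `A` is third power-associative: `(x, x, x) = 0` for all `x`. -/
def IsThirdPowerAssociative (A : Type*) [NonUnitalNonAssocRing A] : Prop :=
  ∀ x : A, associator x x x = 0

/-- `A` and `B` are isomorphic as real algebras: there is a bijective `ℝ`-linear multiplicative
map from `A` to `B`. -/
def AreIsomorphicAlgebras (A B : Type*) [NonUnitalNonAssocRing A] [Module ℝ A]
    [NonUnitalNonAssocRing B] [Module ℝ B] : Prop :=
  ∃ φ : A →ₙₐ[ℝ] B, Function.Bijective φ

/-- The standard isotope of the quaternions whose product is `x ⊙ y = x̄ ȳ`: a copy of the real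
vector space `ℍ`, endowed with this product below. -/
def DoubleStarQuaternion : Type := ℍ

namespace DoubleStarQuaternion

noncomputable instance : AddCommGroup DoubleStarQuaternion := inferInstanceAs (AddCommGroup ℍ)

noncomputable instance : Module ℝ DoubleStarQuaternion := inferInstanceAs (Module ℝ ℍ)

/-- The identity map, as a linear isomorphism onto the quaternions. -/
noncomputable def toQuaternion : DoubleStarQuaternion ≃ₗ[ℝ] ℍ := LinearEquiv.refl ℝ ℍ

noncomputable instance : Mul DoubleStarQuaternion where
  mul x y := toQuaternion.symm (star (toQuaternion x) * star (toQuaternion y))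

theorem mul_def (x y : DoubleStarQuaternion) :
    x * y = toQuaternion.symm (star (toQuaternion x) * star (toQuaternion y)) := rfl

noncomputable instance : NonUnitalNonAssocRing DoubleStarQuaternion where
  left_distrib x y z := by simp [mul_def, mul_add]
  right_distrib x y z := by simp [mul_def, add_mul]
  zero_mul x := by simp [mul_def]
  mul_zero x := by simp [mul_def]

end DoubleStarQuaternion

/-!
The implications between the identities and the classification rest on one normal form: every
absolute-valued algebra of dimension four is, up to isomorphism, `ℍ` with one of the products
`u x y s`, `u x̄ ȳ s`, `u x s ȳ`, `x̄ s y u`, where `u` and `s` are quaternions of norm one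
(`exists_normal_form`).

To reach it, note that multiplications by unit vectors are isometries acting transitively on
spheres, so that averaging over the unit ball produces an invariant inner product and the norm is
Euclidean (`parallelogram_of_transitive`). Dividing the product by two of these isometries gives a
unital composition algebra of dimension four, whose multiplication table is that of `ℍ`
(`exists_linearIsometryEquiv_quaternion`). Hence the product is `φ x * ψ y` with isometries `φ`, `ψ`
of `ℍ`, and these are the maps `p x q` and `p x̄ q` since they are products of reflections
(`exists_eq_mul_mul_of_isometry`).

In the normal form, each of `(x, x, x) = 0` and `(x, x², x) = 0` is an identity between words in
`x`, `x̄`, `u`, `s`. After a conjugation that makes one parameter a complex number, evaluation at a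
few quaternions such as `1`, `i`, `j`, `1 + j`, `i + j` shows that in the first two families `u` and
`s` are `1` or `-1`, so that the algebra is `ℍ` or its double conjugate, and that the last two
families satisfy neither identity (`areIsomorphicAlgebras_of_forms`). Conversely, `ℍ` is flexible
because it is associative, and its double conjugate because norms are central.
-/

/-! ### Quaternions in coordinates -/

/-- The quaternion with real coordinates `a, b, c, d` in the basis `1, i, j, k`. -/
def quat (a b c d : ℝ) : ℍ := ⟨a, b, c, d⟩

@[simp] theorem quat_re (a b c d : ℝ) : (quat a b c d).re = a := rfl
@[simp] theorem quat_imI (a b c d : ℝ) : (quat a b c d).imI = b := rfl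
@[simp] theorem quat_imJ (a b c d : ℝ) : (quat a b c d).imJ = c := rfl
@[simp] theorem quat_imK (a b c d : ℝ) : (quat a b c d).imK = d := rfl

theorem eq_quat (x : ℍ) : x = quat x.re x.imI x.imJ x.imK := rfl

theorem quat_inj {a b c d a' b' c' d' : ℝ} :
    quat a b c d = quat a' b' c' d' ↔ a = a' ∧ b = b' ∧ c = c' ∧ d = d' :=
  Quaternion.ext_iff

theorem one_eq_quat : (1 : ℍ) = quat 1 0 0 0 := rfl

theorem quat_mul (a b c d a' b' c' d' : ℝ) : quat a b c d * quat a' b' c' d' =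
    quat (a * a' - b * b' - c * c' - d * d') (a * b' + b * a' + c * d' - d * c')
      (a * c' - b * d' + c * a' + d * b') (a * d' + b * c' - c * b' + d * a') := by
  ext <;> simp

theorem neg_quat (a b c d : ℝ) : -quat a b c d = quat (-a) (-b) (-c) (-d) := by
  ext <;> simp

theorem star_quat (a b c d : ℝ) : star (quat a b c d) = quat a (-b) (-c) (-d) := by
  ext <;> simp

/-- Every quaternion is conjugate to a complex number `c + d i`. With `w` the imaginary part of `s`
and `r = |w|`, the element `i r + w` intertwines `w` and `i r`, unless `w = -i r`. -/
theorem exists_starAlgEquiv_apply_eq_quat (s : ℍ) :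
    ∃ (σ : ℍ ≃⋆ₐ[ℝ] ℍ) (c d : ℝ), σ s = quat c d 0 0 := by
  suffices h : ∃ (g : ℍ) (c d : ℝ), g ≠ 0 ∧ g * s = quat c d 0 0 * g by
    obtain ⟨g, c, d, hg, hs⟩ := h
    have hn : ‖g‖ ≠ 0 := norm_ne_zero_iff.2 hg
    have h1 : g * star g = ((‖g‖ * ‖g‖ : ℝ) : ℍ) := by
      rw [Quaternion.self_mul_star, Quaternion.normSq_eq_norm_mul_self]
    have h2 : star g * g = ((‖g‖ * ‖g‖ : ℝ) : ℍ) := by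
      rw [Quaternion.star_mul_self, Quaternion.normSq_eq_norm_mul_self]
    have key : ‖g‖⁻¹ • ‖g‖⁻¹ • ((‖g‖ * ‖g‖ : ℝ) : ℍ) = 1 := by
      rw [smul_smul, ← Quaternion.coe_smul, smul_eq_mul]
      field_simp
      simp
    have hu : ‖g‖⁻¹ • g ∈ unitary ℍ := by
      rw [Unitary.mem_iff]
      constructor <;> simp only [Quaternion.star_smul, smul_mul_assoc, mul_smul_comm, h1, h2, key]
    refine ⟨Unitary.conjStarAlgAut ℝ ℍ ⟨_, hu⟩, c, d, ?_⟩
    simp only [Unitary.conjStarAlgAut_apply, Quaternion.star_smul, smul_mul_assoc, mul_smul_comm]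
    rw [hs, mul_assoc, h1, ← mul_smul_comm, ← mul_smul_comm, key, mul_one]
  set r := Real.sqrt (s.imI ^ 2 + s.imJ ^ 2 + s.imK ^ 2)
  have hr2 : r ^ 2 = s.imI ^ 2 + s.imJ ^ 2 + s.imK ^ 2 := Real.sq_sqrt (by positivity)
  by_cases h : quat 0 (s.imI + r) s.imJ s.imK = 0
  · refine ⟨1, s.re, -r, one_ne_zero, ?_⟩
    simp only [Quaternion.ext_iff, Quaternion.re_zero, Quaternion.imI_zero, Quaternion.imJ_zero,
      Quaternion.imK_zero, quat_imI, quat_imJ, quat_imK] at h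
    ext <;> simp <;> linarith
  · refine ⟨_, s.re, r, h, ?_⟩
    ext <;> simp <;> linarith

theorem quat_i_mul_self : quat 0 1 0 0 * quat 0 1 0 0 = -1 := by
  simp [one_eq_quat, quat_mul, neg_quat]

theorem quat_i_ne_zero : quat 0 1 0 0 ≠ 0 :=
  fun h => by simpa [h] using quat_i_mul_self

theorem star_quat_i : star (quat 0 1 0 0) = -quat 0 1 0 0 := by
  simp [star_quat, neg_quat]

theorem mul_quat_i_mul_quat_i (x : ℍ) : x * quat 0 1 0 0 * quat 0 1 0 0 = -x := by
  rw [mul_assoc, quat_i_mul_self, mul_neg_one]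

theorem quat_i_mul_quat_comm (c d : ℝ) :
    quat 0 1 0 0 * quat c d 0 0 = quat c d 0 0 * quat 0 1 0 0 := by
  rw [quat_mul, quat_mul, quat_inj]
  refine ⟨?_, ?_, ?_, ?_⟩ <;> ring

theorem eq_quat_of_commute_i {u : ℍ} (h : u * quat 0 1 0 0 = quat 0 1 0 0 * u) :
    u = quat u.re u.imI 0 0 := by
  simp [Quaternion.ext_iff] at h
  ext <;> simp <;> linarith

theorem eq_quat_of_commute_i_j {u : ℍ} (h : u * quat 0 1 0 0 = quat 0 1 0 0 * u)
    (h' : u * quat 0 0 1 0 = quat 0 0 1 0 * u) : u = quat u.re 0 0 0 := by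
  simp [Quaternion.ext_iff] at h h'
  ext <;> simp <;> linarith

theorem eq_quat_of_anticommute_i {u : ℍ} (h : u * quat 0 1 0 0 = -(quat 0 1 0 0 * u)) :
    u = quat 0 0 u.imJ u.imK := by
  simp [Quaternion.ext_iff] at h
  ext <;> simp <;> linarith

theorem quat_mul_star_eq_one_iff {a b : ℝ} :
    quat a b 0 0 * star (quat a b 0 0) = 1 ↔ a ^ 2 + b ^ 2 = 1 := by
  simp only [star_quat, quat_mul, one_eq_quat, quat_inj]
  constructor
  · rintro ⟨h, -⟩; linarith
  · intro h; exact ⟨by linarith, by ring, by ring, by ring⟩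

theorem quat_eq_one_or {a b : ℝ} (h : a ^ 2 + b ^ 2 = 1) (hb : b = 0) :
    quat a b 0 0 = 1 ∨ quat a b 0 0 = -1 := by
  subst hb
  have : a * a = 1 := by linarith
  rcases mul_self_eq_one_iff.1 this with rfl | rfl
  · left; rfl
  · right; simp [one_eq_quat, neg_quat]

theorem eq_one_or_of_map {σ : ℍ ≃⋆ₐ[ℝ] ℍ} {c : ℍ} (h : σ c = 1 ∨ σ c = -1) : c = 1 ∨ c = -1 :=
  h.imp (fun h => σ.injective (h.trans (map_one σ).symm))
    (fun h => σ.injective (h.trans (by rw [map_neg, map_one])))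

/-! ### Isotopes of `ℍ` with both factors or no factor conjugated -/

/-- If `c z² d` commutes with `z` for every `z`, then `c` and `d` are real. Imaginary units `z` show
that `c d` is real, and `z = 1 + i + j`, in coordinates where `c` is complex, that `c` is. -/
theorem eq_one_or_of_mul_sq_mul_commute {c d : ℍ} (hc : c * star c = 1) (hd : d * star d = 1)
    (h : ∀ z, c * z * z * d * z = z * (c * z * z * d)) : (c = 1 ∨ c = -1) ∧ (d = 1 ∨ d = -1) := by
  have hcd : ∀ z : ℍ, z * z = -1 → c * d * z = z * (c * d) := by
    intro z hz
    have := h z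
    simp only [mul_assoc c z z, hz] at this
    simpa [mul_assoc] using this
  have hr := eq_quat_of_commute_i_j (hcd (quat 0 1 0 0) quat_i_mul_self)
    (hcd (quat 0 0 1 0) (by simp [one_eq_quat, quat_mul, neg_quat]))
  set r := (c * d).re
  have hd' : d = star c * quat r 0 0 0 := by
    rw [← hr, ← mul_assoc, mul_eq_one_comm.1 hc, one_mul]
  have hr1 : quat r 0 0 0 = 1 ∨ quat r 0 0 0 = -1 := by
    apply quat_eq_one_or _ rfl
    rw [← quat_mul_star_eq_one_iff, ← hr, star_mul, mul_assoc, ← mul_assoc d, hd, one_mul, hc]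
  have hc1 : c = 1 ∨ c = -1 := by
    obtain ⟨σ, a, b, hs⟩ := exists_starAlgEquiv_apply_eq_quat c
    have h2 : ∀ z, σ c * z * z * σ (star c) * z = z * (σ c * z * z * σ (star c)) := by
      intro z
      have := h (σ.symm z)
      rw [hd'] at this
      rcases hr1 with hr1 | hr1 <;> simpa [hr1] using congrArg σ this
    have hcc := congrArg σ hc
    simp only [map_mul, map_star, map_one, hs] at h2 hcc
    rw [quat_mul_star_eq_one_iff] at hcc
    apply eq_one_or_of_map (σ := σ)
    rw [hs]
    apply quat_eq_one_or hcc
    have h3 := h2 (quat 1 1 1 0)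
    simp only [quat_mul, star_quat, quat_inj] at h3
    ring_nf at h3
    obtain ⟨h3, h4, h5, h6⟩ := h3
    nlinarith
  refine ⟨hc1, ?_⟩
  rw [hd']
  rcases hc1 with rfl | rfl <;> simpa [neg_eq_iff_eq_neg, or_comm] using hr1

/-- If the product `x ⊙ y = u x y s` satisfies `(x, x², x) = 0`, then `u` and `s` are real.
Outer factors `u` and `s` are cancelled in `h`. After a conjugation `s` is complex. Then `z = i`
shows that `u` is complex as well, `z = j` that `u² = s²`, and `z = 1 + j`, `z = i + j` that
the imaginary part of `u` vanishes. -/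
theorem eq_one_or_of_mul_isotope {u s : ℍ} (hu : u * star u = 1) (hs : s * star s = 1)
    (h : ∀ z, u * z * u * z * z * s * s * z = z * u * u * z * z * s * z * s) :
    (u = 1 ∨ u = -1) ∧ (s = 1 ∨ s = -1) := by
  obtain ⟨σ, c, d, hσ⟩ := exists_starAlgEquiv_apply_eq_quat s
  suffices H : (σ u = 1 ∨ σ u = -1) ∧ (σ s = 1 ∨ σ s = -1) from
    ⟨eq_one_or_of_map H.1, eq_one_or_of_map H.2⟩
  have hU := congrArg σ hu
  have hS := congrArg σ hs
  have h2 : ∀ z, σ u * z * σ u * z * z * σ s * σ s * z =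
      z * σ u * σ u * z * z * σ s * z * σ s := by
    intro z
    simpa using congrArg σ (h (σ.symm z))
  simp only [map_mul, map_star, map_one] at hU hS
  generalize σ u = U at *
  generalize σ s = S at *
  have hU0 : U ≠ 0 := left_ne_zero_of_mul_eq_one hU
  have hS0 : S ≠ 0 := left_ne_zero_of_mul_eq_one hS
  have hUi : U * quat 0 1 0 0 = quat 0 1 0 0 * U := by
    have h3 := h2 (quat 0 1 0 0)
    have hSi : S * quat 0 1 0 0 = quat 0 1 0 0 * S := by rw [hσ, quat_i_mul_quat_comm]
    have h4 : U * quat 0 1 0 0 * U * (quat 0 1 0 0 * quat 0 1 0 0 * (S * S * quat 0 1 0 0)) =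
        quat 0 1 0 0 * U * U * (quat 0 1 0 0 * quat 0 1 0 0 * (S * S * quat 0 1 0 0)) := by
      have h5 : S * S * quat 0 1 0 0 = S * quat 0 1 0 0 * S := by rw [mul_assoc, mul_assoc, hSi]
      nth_rewrite 2 [h5]
      simpa only [mul_assoc] using h3
    exact mul_right_cancel₀ hU0 (mul_right_cancel₀
      (mul_ne_zero (mul_ne_zero quat_i_ne_zero quat_i_ne_zero)
        (mul_ne_zero (mul_ne_zero hS0 hS0) quat_i_ne_zero)) h4)
  obtain ⟨a, b, rfl⟩ : ∃ a b, U = quat a b 0 0 := ⟨_, _, eq_quat_of_commute_i hUi⟩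
  subst hσ
  rw [quat_mul_star_eq_one_iff] at hU hS
  have hj := h2 (quat 0 0 1 0)
  simp only [quat_mul, mul_zero, zero_mul, mul_one, one_mul, add_zero, zero_add, sub_zero,
    zero_sub] at hj
  simp only [quat_inj] at hj
  obtain ⟨hj1, hj2, -, -⟩ := hj
  have hsq1 : c ^ 2 - d ^ 2 = a ^ 2 - b ^ 2 := by
    have : (a ^ 2 + b ^ 2) * (c ^ 2 - d ^ 2) = (c ^ 2 + d ^ 2) * (a ^ 2 - b ^ 2) := by linarith
    simpa [hU, hS] using this
  have hsq2 : c * d = a * b := by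
    have : (a ^ 2 + b ^ 2) * (c * d) = (c ^ 2 + d ^ 2) * (a * b) := by linarith
    simpa [hU, hS] using this
  have hb : b = 0 := by
    have h3 := h2 (quat 1 0 1 0)
    have h4 := h2 (quat 0 1 1 0)
    simp only [quat_mul, mul_zero, zero_mul, mul_one, one_mul, add_zero, zero_add, sub_zero,
      zero_sub] at h3 h4
    simp only [quat_inj] at h3 h4
    obtain ⟨-, -, -, h3⟩ := h3
    obtain ⟨-, -, -, h4⟩ := h4
    have hab : a * b = 0 := by
      linear_combination (-1 / 8) * h3 - a * b / 2 * hS - c * d / 2 * hU - 1 / 2 * hsq2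
    have hc : c ^ 2 = a ^ 2 := by linarith
    have hd : d ^ 2 = b ^ 2 := by linarith
    have : b ^ 4 = 0 := by
      linear_combination (-1 / 8) * h4 + 2 * a * b * hsq2 + b ^ 2 / 2 * hc - b ^ 2 * hd +
        a ^ 2 / 2 * hd + 3 * a * b * hab
    exact pow_eq_zero_iff (by norm_num) |>.1 this
  refine ⟨quat_eq_one_or hU hb, quat_eq_one_or hS ?_⟩
  nlinarith

/-- If the product `x ⊙ y = u x̄ ȳ s` satisfies `(x, x², x) = 0`, then `u` and `s` are real.
Outer factors `u` and `s` are cancelled in `h`. After a conjugation `s` is complex. Then `x = i`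
shows that `u` is complex as well, and `x = i + j` that both imaginary parts
vanish. -/
theorem eq_one_or_of_star_mul_star_isotope {u s : ℍ} (hu : u * star u = 1) (hs : s * star s = 1)
    (h : ∀ x, star s * u * star x * star x * s * x * star u * star x =
      star x * star s * x * u * star x * star x * s * star u) :
    (u = 1 ∨ u = -1) ∧ (s = 1 ∨ s = -1) := by
  obtain ⟨σ, c, d, hσ⟩ := exists_starAlgEquiv_apply_eq_quat s
  suffices H : (σ u = 1 ∨ σ u = -1) ∧ (σ s = 1 ∨ σ s = -1) from
    ⟨eq_one_or_of_map H.1, eq_one_or_of_map H.2⟩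
  have hU := congrArg σ hu
  have hS := congrArg σ hs
  have h2 : ∀ x, star (σ s) * σ u * star x * star x * σ s * x * star (σ u) * star x =
      star x * star (σ s) * x * σ u * star x * star x * σ s * star (σ u) := by
    intro x
    simpa [map_star] using congrArg σ (h (σ.symm x))
  simp only [map_mul, map_star, map_one] at hU hS
  generalize σ u = U at *
  generalize σ s = S at *
  have hU0 : U ≠ 0 := left_ne_zero_of_mul_eq_one hU
  have hS0 : S ≠ 0 := left_ne_zero_of_mul_eq_one hS
  have hUi : star U * quat 0 1 0 0 = quat 0 1 0 0 * star U := by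
    have h3 := h2 (quat 0 1 0 0)
    have hSi : quat 0 1 0 0 * star S = star S * quat 0 1 0 0 := by
      rw [hσ, star_quat, neg_zero, quat_i_mul_quat_comm]
    simp only [star_quat_i, mul_neg, neg_mul, neg_neg, mul_quat_i_mul_quat_i, hSi] at h3
    have h4 : star S * (U * (S * (quat 0 1 0 0 * star U * quat 0 1 0 0))) =
        star S * (U * (S * (- star U))) := by
      simpa only [mul_assoc, mul_neg] using h3
    have h5 := mul_left_cancel₀ hS0 (mul_left_cancel₀ hU0 (mul_left_cancel₀
      (star_ne_zero.2 hS0) h4))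
    have h6 := congrArg (· * quat 0 1 0 0) h5
    simp only [mul_quat_i_mul_quat_i] at h6
    simpa using h6.symm
  have hb : ∃ a b, U = quat a b 0 0 := by
    have := eq_quat_of_commute_i hUi
    refine ⟨(star U).re, -(star U).imI, ?_⟩
    rw [← star_star U, this]
    simp [star_quat]
  obtain ⟨a, b, rfl⟩ := hb
  subst hσ
  rw [quat_mul_star_eq_one_iff] at hU hS
  have h3 := h2 (quat 0 1 1 0)
  simp only [star_quat, neg_zero, quat_mul, mul_zero, zero_mul, mul_one, add_zero, zero_add,
    sub_zero, zero_sub] at h3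
  simp only [quat_inj] at h3
  obtain ⟨-, -, -, h3⟩ := h3
  have : b ^ 2 + d ^ 2 = 0 := by
    linear_combination (1 / 4) * h3 - b ^ 2 * hS - d ^ 2 * hU
  exact ⟨quat_eq_one_or hU (by nlinarith), quat_eq_one_or hS (by nlinarith)⟩

/-! ### Isotopes of `ℍ` with one conjugated factor -/

/-- The product `x ⊙ y = p x n ȳ` is never third power-associative; `h` is that identity with a left
factor `p` cancelled. After a conjugation `n` is complex. Then `x = 1` and `x = i` show that `p`
anticommutes with `i`, and `x = p` that `n` is real, which contradicts the relation `p n² = p̄`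
coming from `x = 1`. -/
theorem false_of_mul_star_isotope_cube {p n : ℍ} (hp : p * star p = 1) (hn : n * star n = 1)
    (h : ∀ x, p * x * n * star x * n * star x = x * n * x * star n * star x * star p) : False := by
  obtain ⟨σ, c, d, hσ⟩ := exists_starAlgEquiv_apply_eq_quat n
  replace hp := congrArg σ hp
  replace hn := congrArg σ hn
  replace h : ∀ x, σ p * x * σ n * star x * σ n * star x =
      x * σ n * x * star (σ n) * star x * star (σ p) := by
    intro x
    simpa [map_star] using congrArg σ (h (σ.symm x))
  simp only [map_mul, map_star, map_one] at hp hn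
  generalize σ p = P at *
  generalize σ n = N at *
  have h1 := h 1
  simp only [star_one, mul_one, one_mul, hn] at h1
  have hNi : quat 0 1 0 0 * N = N * quat 0 1 0 0 := by rw [hσ, quat_i_mul_quat_comm]
  have hNi' : ∀ x, x * quat 0 1 0 0 * N = x * N * quat 0 1 0 0 := by
    intro x; rw [mul_assoc, hNi, mul_assoc]
  have hPi : P * quat 0 1 0 0 = -(quat 0 1 0 0 * P) := by
    have h2 := h (quat 0 1 0 0)
    simp only [star_quat_i, mul_neg, neg_mul, neg_neg, mul_quat_i_mul_quat_i,
      hNi, hNi', hn, h1, one_mul] at h2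
    have h3 := congrArg star h2
    simp only [star_mul, star_neg, star_star, star_quat_i, neg_mul, mul_neg, neg_neg] at h3
    rw [h3, neg_neg]
  have hP0 := eq_quat_of_anticommute_i hPi
  generalize P.imJ = e at hP0
  generalize P.imK = f at hP0
  subst hP0 hσ
  have h3 := h (quat 0 0 e f)
  simp only [star_quat, one_eq_quat, neg_zero, quat_mul, mul_zero, zero_mul, add_zero, zero_add,
    sub_zero, zero_sub] at h1 h3 hn hp
  simp only [quat_inj] at h1 h3 hn hp
  have hp' : e ^ 2 + f ^ 2 = 1 := by linarith [hp.1]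
  have hd : d ^ 2 = 0 := by
    linear_combination (1 / 2) * h3.1 - d ^ 2 * (e ^ 2 + f ^ 2 + 1) * hp'
  have hd0 : d = 0 := by simpa using hd
  subst hd0
  have hc : c ^ 2 = 1 := by linarith [hn.1]
  have he : e = 0 := by linear_combination (1 / 2) * h1.2.2.1 - e / 2 * hc
  have hf : f = 0 := by linear_combination (1 / 2) * h1.2.2.2 - f / 2 * hc
  simp [he, hf] at hp'

/-- The product `x ⊙ y = p x n ȳ` never satisfies `(x, x², x) = 0`; `h` is that identity with a left
factor `p` cancelled. After a conjugation `n` is complex. Then `x = 1` and `x = i` show that `p`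
anticommutes with `i`, hence that `n² = -1`, and `x = j`, `x = k` that both coordinates of
`p` vanish. -/
theorem false_of_mul_star_isotope_sq {p n : ℍ} (hp : p * star p = 1) (hn : n * star n = 1)
    (h : ∀ x, p * x * n * x * star n * star x * star p * n * star x =
      x * n * x * star n * x * star n * star x * star p * star p) : False := by
  obtain ⟨σ, c, d, hσ⟩ := exists_starAlgEquiv_apply_eq_quat n
  replace hp := congrArg σ hp
  replace hn := congrArg σ hn
  replace h : ∀ x, σ p * x * σ n * x * star (σ n) * star x * star (σ p) * σ n * star x =
      x * σ n * x * star (σ n) * x * star (σ n) * star x * star (σ p) * star (σ p) := by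
    intro x
    simpa [map_star] using congrArg σ (h (σ.symm x))
  simp only [map_mul, map_star, map_one] at hp hn
  generalize σ p = P at *
  generalize σ n = N at *
  have h1 := h 1
  simp only [star_one, mul_one, one_mul, hn, hp, mul_assoc P] at h1
  have hNi : quat 0 1 0 0 * N = N * quat 0 1 0 0 := by rw [hσ, quat_i_mul_quat_comm]
  have hNi' : ∀ x, x * quat 0 1 0 0 * N = x * N * quat 0 1 0 0 := by
    intro x; rw [mul_assoc, hNi, mul_assoc]
  have hNs : quat 0 1 0 0 * star N = star N * quat 0 1 0 0 := by
    have := congrArg star hNi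
    simp only [star_mul, star_quat_i, mul_neg, neg_mul, neg_inj] at this
    exact this.symm
  have hNN : ∀ x, x * N * star N = x := by
    intro x; rw [mul_assoc, hn, mul_one]
  have hPi : P * quat 0 1 0 0 = -(quat 0 1 0 0 * P) := by
    have h2 := h (quat 0 1 0 0)
    simp only [star_quat_i, mul_neg, neg_mul, neg_neg, mul_quat_i_mul_quat_i,
      hNi, hNi', hNs, hn, hNN, one_mul] at h2
    rw [mul_assoc _ (star P), mul_assoc _ (star P), ← mul_assoc (star N), ← h1, neg_inj] at h2
    have h3 := congrArg (· * quat 0 1 0 0) h2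
    simp only [mul_quat_i_mul_quat_i, ← hNi] at h3
    rw [← neg_mul, ← mul_assoc] at h3
    have h4 := mul_right_cancel₀ (left_ne_zero_of_mul_eq_one hn) h3
    have h5 : -(P * quat 0 1 0 0) * (star P * P) = quat 0 1 0 0 * P := by rw [← mul_assoc, h4]
    rw [mul_eq_one_comm.1 hp, mul_one] at h5
    rw [← h5, neg_neg]
  have hP0 := eq_quat_of_anticommute_i hPi
  generalize P.imJ = e at hP0
  generalize P.imK = f at hP0
  subst hP0 hσ
  have h4 := h (quat 0 0 1 0)
  have h5 := h (quat 0 0 0 1)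
  simp only [star_quat, one_eq_quat, neg_zero, quat_mul, mul_zero, zero_mul, mul_one, one_mul,
    add_zero, zero_add, sub_zero, zero_sub] at h1 h4 h5 hn hp
  simp only [quat_inj] at h1 h4 h5 hn hp
  have hp' : e ^ 2 + f ^ 2 = 1 := by linarith [hp.1]
  have hc0 : c = 0 := by linear_combination (1 / 2) * h1.1 - c / 2 * hp'
  subst hc0
  have hd : d ^ 2 = 1 := by linarith [hn.1]
  have hd0 : d ≠ 0 := by rintro rfl; simp at hd
  have he : d ^ 3 * e ^ 2 = 0 := by linear_combination (1 / 2) * h4.2.1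
  have hf : d ^ 3 * f ^ 2 = 0 := by linear_combination (1 / 2) * h5.2.1
  simp only [mul_eq_zero, pow_eq_zero_iff, ne_eq, OfNat.ofNat_ne_zero, not_false_eq_true, hd0,
    false_or] at he hf
  simp [he, hf] at hp'

/-! ### Linear isometries of the quaternions -/

theorem mul_star_mul_eq (v x : ℍ) :
    v * star x * v = (2 * inner ℝ v x) • v - (‖v‖ ^ 2) • x := by
  rw [Quaternion.inner_def, pow_two, ← Quaternion.normSq_eq_norm_mul_self, Quaternion.normSq_def']
  ext <;> simp <;> ring

/-- The reflection of `ℍ` in the hyperplane orthogonal to a unit vector `w` is `x ↦ -w x̄ w`;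
for `v = 0` the hyperplane degenerates to the whole space. -/
theorem exists_reflection_eq (v : ℍ) : ((ℝ ∙ v)ᗮ.reflection = 1) ∨
    ∃ w : ℍ, w * star w = 1 ∧ ∀ x, (ℝ ∙ v)ᗮ.reflection x = -(w * star x * w) := by
  rcases eq_or_ne v 0 with rfl | hv
  · left
    ext1 x
    exact (Submodule.reflection_eq_self_iff x).2 (by simp)
  · right
    have hn : ‖v‖ ≠ 0 := norm_ne_zero_iff.2 hv
    refine ⟨‖v‖⁻¹ • v, ?_, fun x => ?_⟩
    · simp only [Quaternion.star_smul, smul_mul_assoc, mul_smul_comm, Quaternion.self_mul_star,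
        Quaternion.normSq_eq_norm_mul_self]
      rw [smul_smul, ← Quaternion.coe_smul, smul_eq_mul]
      field_simp
      simp
    · rw [Submodule.reflection_orthogonal_apply, Submodule.reflection_singleton_apply,
        smul_mul_assoc, smul_mul_assoc, mul_smul_comm, mul_star_mul_eq, smul_sub, smul_sub,
        smul_smul, smul_smul, smul_smul, smul_smul, two_smul, ← add_smul]
      have h1 : ‖v‖⁻¹ * ‖v‖⁻¹ * ‖v‖ ^ 2 = 1 := by field_simp
      have h2 : ‖v‖⁻¹ * ‖v‖⁻¹ * (2 * inner ℝ v x) =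
          inner ℝ v x / ‖v‖ ^ 2 + inner ℝ v x / ‖v‖ ^ 2 := by
        field_simp
        ring
      rw [h1, h2, one_smul]
      rfl

theorem mul_mul_star_mul_eq_one {a b : ℍ} (ha : a * star a = 1) (hb : b * star b = 1) :
    a * b * star (a * b) = 1 := by
  rw [star_mul, mul_assoc, ← mul_assoc b, hb, one_mul, ha]

/-- Linear isometries of `ℍ` are the maps `x ↦ p x q` and `x ↦ p x̄ q` with `p`, `q` of norm one,
because they are products of reflections. -/
theorem exists_eq_mul_mul_of_isometry (φ : ℍ ≃ₗᵢ[ℝ] ℍ) :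
    ∃ p q : ℍ, p * star p = 1 ∧ q * star q = 1 ∧
      ((∀ x, φ x = p * x * q) ∨ ∀ x, φ x = p * star x * q) := by
  obtain ⟨l, -, rfl⟩ := φ.reflections_generate_dim
  induction l with
  | nil => exact ⟨1, 1, by simp, by simp, Or.inl fun x => by simp⟩
  | cons v l ih =>
    obtain ⟨p, q, hp, hq, h⟩ := ih
    rw [List.map_cons, List.prod_cons]
    rcases exists_reflection_eq v with h1 | ⟨w, hw, h1⟩
    · rw [h1, one_mul]
      exact ⟨p, q, hp, hq, h⟩
    · refine ⟨-(w * star q), star p * w, ?_, ?_, ?_⟩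
      · rw [star_neg, neg_mul_neg]
        exact mul_mul_star_mul_eq_one hw (by rw [star_star]; exact mul_eq_one_comm.1 hq)
      · exact mul_mul_star_mul_eq_one (by rw [star_star]; exact mul_eq_one_comm.1 hp) hw
      · rcases h with h | h
        · exact Or.inr fun x => by simp [h1, h, mul_assoc]
        · exact Or.inl fun x => by simp [h1, h, mul_assoc]

/-! ### Norms with a transitive group of isometries -/

open MeasureTheory in
/-- A linear isometry preserves Haar measure: it maps the unit ball onto itself, so that its
determinant is `1` or `-1`. -/
theorem measurePreserving_of_linearIsometryEquiv {E : Type*} [NormedAddCommGroup E]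
    [NormedSpace ℝ E] [FiniteDimensional ℝ E] [MeasurableSpace E] [BorelSpace E]
    (μ : Measure E) [μ.IsAddHaarMeasure] (g : E ≃ₗᵢ[ℝ] E) : MeasurePreserving g μ μ := by
  refine ⟨g.continuous.measurable, ?_⟩
  have hg : LinearMap.det (g.toLinearEquiv : E →ₗ[ℝ] E) ≠ 0 := g.toLinearEquiv.isUnit_det'.ne_zero
  have h := Measure.map_linearMap_addHaar_eq_smul_addHaar μ hg
  have hcoe : ((g.toLinearEquiv : E →ₗ[ℝ] E) : E → E) = g := rfl
  rw [hcoe] at h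
  have hball := congrArg (fun ν : Measure E => ν (Metric.ball 0 1)) h
  simp only [Measure.smul_apply, smul_eq_mul] at hball
  rw [Measure.map_apply g.continuous.measurable measurableSet_ball, g.preimage_ball,
    map_zero] at hball
  have h1 : ENNReal.ofReal |(LinearMap.det (g.toLinearEquiv : E →ₗ[ℝ] E))⁻¹| = 1 := by
    have h0 : μ (Metric.ball (0 : E) 1) ≠ 0 := (Metric.measure_ball_pos μ 0 one_pos).ne'
    have ht : μ (Metric.ball (0 : E) 1) ≠ ⊤ := measure_ball_lt_top.ne
    exact (ENNReal.mul_left_inj h0 ht).1 (by rw [← hball, one_mul])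
  rw [h, h1, one_smul]

open MeasureTheory in
/-- A finite-dimensional norm whose isometry group is transitive on spheres satisfies the
parallelogram law. The map `T f = ∫ x in K, f x • x` from the dual space to the space, where `K` is
the unit ball, is invertible and commutes with all isometries, so that `q x = T⁻¹ x x` is a
quadratic form invariant under them. By transitivity it is a multiple of the square of the norm. -/
theorem parallelogram_of_transitive {E : Type*} [NormedAddCommGroup E] [NormedSpace ℝ E]
    [FiniteDimensional ℝ E]
    (htrans : ∀ x y : E, ‖x‖ = ‖y‖ → ∃ g : E ≃ₗᵢ[ℝ] E, g x = y) (x y : E) :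
    ‖x + y‖ * ‖x + y‖ + ‖x - y‖ * ‖x - y‖ = 2 * (‖x‖ * ‖x‖ + ‖y‖ * ‖y‖) := by
  let : MeasurableSpace E := borel E
  have : BorelSpace E := ⟨rfl⟩
  let μ : Measure E := Measure.addHaar
  let K : Set E := Metric.closedBall 0 1
  have hK : IsCompact K := isCompact_closedBall 0 1
  have hint (f : Module.Dual ℝ E) : IntegrableOn (fun x => f x • x) K μ :=
    ((f.continuous_of_finiteDimensional.smul continuous_id).continuousOn).integrableOn_compact hK
  let T : Module.Dual ℝ E →ₗ[ℝ] E :=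
    { toFun f := ∫ x in K, f x • x ∂μ
      map_add' f g := by
        simp only [LinearMap.add_apply, add_smul]
        exact integral_add (hint f) (hint g)
      map_smul' c f := by
        simp only [LinearMap.smul_apply, smul_assoc, RingHom.id_apply]
        exact integral_smul c _ }
  have hTdef (f) : T f = ∫ x in K, f x • x ∂μ := rfl
  -- `f (T f)` is the integral of `f ^ 2` over the ball, so `T` is injective.
  have hpos (f : Module.Dual ℝ E) (hf : f ≠ 0) : 0 < f (T f) := by
    have h1 : f (T f) = ∫ x in K, f x * f x ∂μ := by
      have := (ContinuousLinearMap.integral_comp_comm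
        (LinearMap.toContinuousLinearMap f) (hint f)).symm
      rw [hTdef]
      simpa using this
    rw [h1]
    have hc : Continuous fun x => f x * f x :=
      f.continuous_of_finiteDimensional.mul f.continuous_of_finiteDimensional
    rw [setIntegral_pos_iff_support_of_nonneg_ae
      (Filter.Eventually.of_forall fun x => mul_self_nonneg _)
      (hc.continuousOn.integrableOn_compact hK)]
    have hopen : IsOpen ((Function.support fun x => f x * f x) ∩ Metric.ball 0 1) :=
      hc.isOpen_support.inter Metric.isOpen_ball
    refine (hopen.measure_pos μ ?_).trans_le
      (measure_mono (Set.inter_subset_inter_right _ Metric.ball_subset_closedBall))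
    obtain ⟨v, hv⟩ : ∃ v, f v ≠ 0 := by
      by_contra! h
      exact hf (LinearMap.ext h)
    have hv0 : 0 < ‖v‖ := norm_pos_iff.2 fun h => hv (by simp [h])
    refine ⟨(2 * ‖v‖)⁻¹ • v, ?_, ?_⟩
    · simp [hv, hv0.ne']
    · rw [mem_ball_zero_iff, norm_smul, norm_inv, norm_mul, norm_norm, Real.norm_ofNat]
      field_simp
      norm_num
  have hinj : Function.Injective T := by
    rw [injective_iff_map_eq_zero]
    intro f hf
    by_contra h
    have := hpos f h
    simp [hf] at this
  let Te : Module.Dual ℝ E ≃ₗ[ℝ] E :=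
    LinearEquiv.ofInjectiveOfFinrankEq T hinj Subspace.dual_finrank_eq
  have hTe (f) : Te f = T f := rfl
  -- Equivariance of `T`, by the substitution `y = g x` in the integral.
  have hequiv (g : E ≃ₗᵢ[ℝ] E) (f : Module.Dual ℝ E) :
      g (T (f ∘ₗ (g.toLinearEquiv : E →ₗ[ℝ] E))) = T f := by
    have h1 := (measurePreserving_of_linearIsometryEquiv μ g).setIntegral_preimage_emb
      g.toHomeomorph.measurableEmbedding (fun y => f y • y) K
    rw [hTdef, hTdef, ← h1]
    have h2 : g ⁻¹' K = K := by
      simp only [K]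
      rw [g.preimage_closedBall, map_zero]
    rw [h2]
    have := (ContinuousLinearMap.integral_comp_comm (g : E →L[ℝ] E)
      (hint (f ∘ₗ (g.toLinearEquiv : E →ₗ[ℝ] E)))).symm
    simpa using this
  let q (x : E) : ℝ := Te.symm x x
  have hq (x : E) : q x = Te.symm x x := rfl
  have hinv (g : E ≃ₗᵢ[ℝ] E) (x : E) : q (g x) = q x := by
    have h1 : Te.symm x = Te.symm (g x) ∘ₗ (g.toLinearEquiv : E →ₗ[ℝ] E) := by
      rw [LinearEquiv.symm_apply_eq, hTe]
      apply g.injective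
      rw [hequiv, ← hTe, LinearEquiv.apply_symm_apply]
    rw [hq, hq, h1]
    rfl
  rcases subsingleton_or_nontrivial E with hE | hE
  · simp [Subsingleton.elim x 0, Subsingleton.elim y 0]
  obtain ⟨e, he⟩ := exists_norm_eq E zero_le_one
  have hscale (x : E) : q x = ‖x‖ * ‖x‖ * q e := by
    obtain ⟨g, hg⟩ := htrans (‖x‖ • e) x (by simp [norm_smul, he])
    rw [← hg, hinv, hg, hq, hq]
    simp [mul_assoc]
  have hqe : q e ≠ 0 := by
    have h1 : Te.symm e ≠ 0 := by
      intro h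
      have : e = 0 := by simpa using h
      simp [this] at he
    have := hpos _ h1
    rw [← hTe, LinearEquiv.apply_symm_apply] at this
    exact this.ne'
  have hpar : q (x + y) + q (x - y) = 2 * (q x + q y) := by
    simp only [hq, map_add, map_sub, LinearMap.add_apply, LinearMap.sub_apply]
    ring
  rw [hscale (x + y), hscale (x - y), hscale x, hscale y] at hpar
  apply mul_right_cancel₀ hqe
  linarith

/-! ### Unital composition algebras of dimension four -/

section Composition

open scoped InnerProductSpace

variable {E : Type*} [NormedAddCommGroup E] [InnerProductSpace ℝ E]

theorem inner_mul_left_mul_left {m : E →ₗ[ℝ] E →ₗ[ℝ] E} (hm : ∀ x y, ‖m x y‖ = ‖x‖ * ‖y‖)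
    (x y z : E) :
    ⟪m x y, m x z⟫_ℝ = ‖x‖ ^ 2 * ⟪y, z⟫_ℝ := by
  rw [real_inner_eq_norm_add_mul_self_sub_norm_mul_self_sub_norm_mul_self_div_two,
    real_inner_eq_norm_add_mul_self_sub_norm_mul_self_sub_norm_mul_self_div_two, ← map_add,
    hm, hm, hm]
  ring

theorem inner_mul_right_mul_right {m : E →ₗ[ℝ] E →ₗ[ℝ] E} (hm : ∀ x y, ‖m x y‖ = ‖x‖ * ‖y‖)
    (x y z : E) :
    ⟪m y x, m z x⟫_ℝ = ‖x‖ ^ 2 * ⟪y, z⟫_ℝ := by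
  simpa using inner_mul_left_mul_left (m := m.flip) (by simp [hm, mul_comm]) x y z

/-- The identity `‖m x y‖ = ‖x‖ ‖y‖`, polarized in both variables. -/
theorem inner_mul_mul_add {m : E →ₗ[ℝ] E →ₗ[ℝ] E} (hm : ∀ x y, ‖m x y‖ = ‖x‖ * ‖y‖)
    (x y z w : E) :
    ⟪m x y, m z w⟫_ℝ + ⟪m x w, m z y⟫_ℝ = 2 * ⟪x, z⟫_ℝ * ⟪y, w⟫_ℝ := by
  have h1 := inner_mul_left_mul_left hm (x + z) y w
  have h2 := inner_mul_left_mul_left hm x y w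
  have h3 := inner_mul_left_mul_left hm z y w
  simp only [map_add, LinearMap.add_apply, inner_add_left, inner_add_right, h2, h3] at h1
  rw [norm_add_sq_real] at h1
  rw [real_inner_comm (m z y) (m x w)]
  linarith

/-- A left multiplication by an element orthogonal to a left unit `e` is skew-adjoint, hence
squares to a negative scalar. -/
theorem mul_mul_self_of_inner_eq_zero {m : E →ₗ[ℝ] E →ₗ[ℝ] E} (hm : ∀ x y, ‖m x y‖ = ‖x‖ * ‖y‖)
    {e : E} (he : ∀ x, m e x = x) {x : E} (hx : ⟪x, e⟫_ℝ = 0) (y : E) :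
    m x (m x y) = -(‖x‖ ^ 2 • y) := by
  refine ext_inner_right ℝ fun z => ?_
  have h1 := inner_mul_mul_add hm x (m x y) e z
  rw [hx, he, he, inner_mul_left_mul_left hm x z y, real_inner_comm] at h1
  rw [inner_neg_left, real_inner_smul_left, real_inner_comm]
  rw [real_inner_comm y z] at h1
  linarith

theorem mul_mul_self_of_inner_eq_zero' {m : E →ₗ[ℝ] E →ₗ[ℝ] E} (hm : ∀ x y, ‖m x y‖ = ‖x‖ * ‖y‖)
    {e : E} (he : ∀ x, m x e = x) {x : E} (hx : ⟪x, e⟫_ℝ = 0) (y : E) :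
    m (m y x) x = -(‖x‖ ^ 2 • y) := by
  simpa using mul_mul_self_of_inner_eq_zero (m := m.flip) (by simp [hm, mul_comm]) (e := e) he hx y

theorem mul_eq_neg_mul_swap {m : E →ₗ[ℝ] E →ₗ[ℝ] E} (hm : ∀ x y, ‖m x y‖ = ‖x‖ * ‖y‖)
    {e : E} (he : ∀ x, m e x = x) (he' : ∀ x, m x e = x) {x y : E} (hx : ⟪x, e⟫_ℝ = 0)
    (hy : ⟪y, e⟫_ℝ = 0) (hxy : ⟪x, y⟫_ℝ = 0) : m x y = -m y x := by
  have h (z : E) (hz : ⟪z, e⟫_ℝ = 0) : m z z = -(‖z‖ ^ 2 • e) := by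
    simpa [he'] using mul_mul_self_of_inner_eq_zero hm he hz e
  have h1 := h (x + y) (by rw [inner_add_left, hx, hy, add_zero])
  rw [norm_add_sq_real, hxy] at h1
  simp only [map_add, LinearMap.add_apply, h x hx, h y hy, mul_zero, add_zero, add_smul] at h1
  rw [eq_neg_iff_add_eq_zero]
  linear_combination (norm := module) h1

theorem exists_norm_eq_one_forall_inner_eq_zero [FiniteDimensional ℝ E] (s : Finset E)
    (hs : s.card < Module.finrank ℝ E) : ∃ x : E, ‖x‖ = 1 ∧ ∀ y ∈ s, ⟪x, y⟫_ℝ = 0 := by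
  have h : (Submodule.span ℝ (s : Set E))ᗮ ≠ ⊥ := by
    intro h
    rw [Submodule.orthogonal_eq_bot_iff] at h
    have := finrank_span_finset_le_card (R := ℝ) s
    rw [Set.finrank, h, finrank_top] at this
    omega
  obtain ⟨v, hv, hv0⟩ := Submodule.exists_mem_ne_zero_of_ne_bot h
  refine ⟨‖v‖⁻¹ • v, by simp [norm_smul, hv0], fun y hy => ?_⟩
  rw [real_inner_smul_left, Submodule.inner_left_of_mem_orthogonal (Submodule.subset_span hy) hv,
    mul_zero]

/-- A four-dimensional Euclidean algebra with unit and multiplicative norm is isomorphic to `ℍ`: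
if `e, i, j` are orthonormal, then so are `e, i, j, i j`, and the composition identities determine
their multiplication table. -/
theorem exists_linearIsometryEquiv_quaternion (hdim : Module.finrank ℝ E = 4)
    {m : E →ₗ[ℝ] E →ₗ[ℝ] E} (hm : ∀ x y, ‖m x y‖ = ‖x‖ * ‖y‖)
    {e : E} (he : ∀ x, m e x = x) (he' : ∀ x, m x e = x) :
    ∃ Ψ : ℍ ≃ₗᵢ[ℝ] E, ∀ x y, Ψ (x * y) = m (Ψ x) (Ψ y) := by
  classical
  have : FiniteDimensional ℝ E := Module.finite_of_finrank_eq_succ hdim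
  have hone : ‖e‖ = 1 := by
    have hne : Nontrivial E := Module.nontrivial_of_finrank_eq_succ hdim
    obtain ⟨x, hx⟩ := exists_norm_eq E zero_le_one
    have := hm e x
    rw [he, hx, mul_one] at this
    exact this.symm
  obtain ⟨i, hi, hie⟩ := exists_norm_eq_one_forall_inner_eq_zero ({e} : Finset E) (by simp [hdim])
  replace hie : ⟪i, e⟫_ℝ = 0 := hie e (by simp)
  obtain ⟨j, hj, hj'⟩ := exists_norm_eq_one_forall_inner_eq_zero ({e, i} : Finset E)
    (Finset.card_le_two.trans_lt (by simp [hdim]))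
  have hje : ⟪j, e⟫_ℝ = 0 := hj' e (by simp)
  have hji : ⟪j, i⟫_ℝ = 0 := hj' i (by simp)
  have hij : ⟪i, j⟫_ℝ = 0 := by rw [real_inner_comm, hji]
  obtain ⟨k, hk⟩ : ∃ k, m i j = k := ⟨_, rfl⟩
  have hkn : ‖k‖ = 1 := by rw [← hk, hm, hi, hj, one_mul]
  have hki : ⟪k, i⟫_ℝ = 0 := by
    have := inner_mul_left_mul_left hm i j e
    rwa [hk, he', hje, mul_zero] at this
  have hkj : ⟪k, j⟫_ℝ = 0 := by
    have := inner_mul_right_mul_right hm j i e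
    rwa [hk, he, hie, mul_zero] at this
  have hke : ⟪k, e⟫_ℝ = 0 := by
    have := inner_mul_mul_add hm i j e e
    rwa [hk, he, he, he', hie, hij, mul_zero, zero_mul, add_zero] at this
  have hii : m i i = -e := by
    have := mul_mul_self_of_inner_eq_zero hm he hie e
    simpa [he', hi] using this
  have hjj : m j j = -e := by
    have := mul_mul_self_of_inner_eq_zero hm he hje e
    simpa [he', hj] using this
  have hkk : m k k = -e := by
    have := mul_mul_self_of_inner_eq_zero hm he hke e
    simpa [he', hkn] using this
  have hik : m i k = -j := by
    rw [← hk]; simpa [hi] using mul_mul_self_of_inner_eq_zero hm he hie j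
  have hkj' : m k j = -i := by
    rw [← hk]; simpa [hj] using mul_mul_self_of_inner_eq_zero' hm he' hje i
  have hji' : m j i = -k := by
    rw [mul_eq_neg_mul_swap hm he he' hje hie hji, hk]
  have hki' : m k i = j := by
    rw [mul_eq_neg_mul_swap hm he he' hke hie hki, hik, neg_neg]
  have hjk : m j k = i := by
    rw [mul_eq_neg_mul_swap hm he he' hje hke (by rw [real_inner_comm, hkj]), hkj', neg_neg]
  let F : ℍ →ₗ[ℝ] E :=
    { toFun x := x.re • e + x.imI • i + x.imJ • j + x.imK • k
      map_add' x y := by simp only [Quaternion.re_add, Quaternion.imI_add, Quaternion.imJ_add,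
        Quaternion.imK_add]; module
      map_smul' c x := by simp only [Quaternion.re_smul, Quaternion.imI_smul, Quaternion.imJ_smul,
        Quaternion.imK_smul, smul_eq_mul, RingHom.id_apply]; module }
  have hF (x : ℍ) : F x = x.re • e + x.imI • i + x.imJ • j + x.imK • k := rfl
  have hnorm (x : ℍ) : ‖F x‖ = ‖x‖ := by
    rw [← sq_eq_sq₀ (norm_nonneg _) (norm_nonneg _), pow_two ‖x‖,
      ← Quaternion.normSq_eq_norm_mul_self, Quaternion.normSq_def',
      ← real_inner_self_eq_norm_sq, hF]
    have hei : ⟪e, i⟫_ℝ = 0 := by rw [real_inner_comm, hie]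
    have hej : ⟪e, j⟫_ℝ = 0 := by rw [real_inner_comm, hje]
    have hek : ⟪e, k⟫_ℝ = 0 := by rw [real_inner_comm, hke]
    have hik : ⟪i, k⟫_ℝ = 0 := by rw [real_inner_comm, hki]
    have hjk : ⟪j, k⟫_ℝ = 0 := by rw [real_inner_comm, hkj]
    simp only [inner_add_left, inner_add_right, real_inner_smul_left, real_inner_smul_right,
      real_inner_self_eq_norm_sq, norm_smul, mul_pow, Real.norm_eq_abs, sq_abs, hie, hje, hji, hij,
      hki, hkj, hke, hei, hej, hek, hik, hjk, hone, hi, hj, hkn]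
    ring
  refine ⟨LinearIsometry.toLinearIsometryEquiv ⟨F, hnorm⟩
    (by rw [hdim, Quaternion.finrank_eq_four]), fun x y => ?_⟩
  change F (x * y) = m (F x) (F y)
  simp only [hF, Quaternion.re_mul, Quaternion.imI_mul, Quaternion.imJ_mul, Quaternion.imK_mul,
    map_add, map_smul, LinearMap.add_apply, LinearMap.smul_apply, he, he', hii, hjj, hkk, hk, hik,
    hkj', hji', hki', hjk]
  module

end Composition

/-! ### Absolute-valued algebras of dimension four -/

/-- A four-dimensional real algebra with multiplicative norm is an isotope of `ℍ`. Left
multiplications by unit vectors are isometries and move a vector to any other of the same norm, so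
the norm is Euclidean. For a unit vector `a`, the product `R_a⁻¹ x * L_a⁻¹ y` has the unit `a * a`
and the same norm, so it is the product of `ℍ`. -/
theorem exists_linearEquiv_quaternion_of_norm_mul {E : Type*} [NormedAddCommGroup E]
    [NormedSpace ℝ E] (hdim : Module.finrank ℝ E = 4) {m : E →ₗ[ℝ] E →ₗ[ℝ] E}
    (hm : ∀ x y, ‖m x y‖ = ‖x‖ * ‖y‖) :
    ∃ (Φ : E ≃ₗ[ℝ] ℍ) (φ ψ : ℍ ≃ₗᵢ[ℝ] ℍ), ∀ x y, Φ (m x y) = φ (Φ x) * ψ (Φ y) := by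
  have : FiniteDimensional ℝ E := Module.finite_of_finrank_eq_succ hdim
  have hL (a : E) (ha : ‖a‖ = 1) : ∃ g : E ≃ₗᵢ[ℝ] E, ∀ x, g x = m a x :=
    ⟨LinearIsometry.toLinearIsometryEquiv ⟨m a, fun x => by rw [hm, ha, one_mul]⟩ rfl, fun _ => rfl⟩
  have hR (a : E) (ha : ‖a‖ = 1) : ∃ g : E ≃ₗᵢ[ℝ] E, ∀ x, g x = m x a :=
    ⟨LinearIsometry.toLinearIsometryEquiv
      ⟨m.flip a, fun x => by rw [LinearMap.flip_apply, hm, ha, mul_one]⟩ rfl, fun _ => rfl⟩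
  have htrans (x y : E) (hxy : ‖x‖ = ‖y‖) : ∃ g : E ≃ₗᵢ[ℝ] E, g x = y := by
    rcases eq_or_ne x 0 with rfl | hx
    · exact ⟨1, by simpa [eq_comm] using hxy⟩
    have hx' : ‖x‖ ≠ 0 := norm_ne_zero_iff.2 hx
    have hinj : Function.Injective (m.flip x) := by
      rw [injective_iff_map_eq_zero]
      intro a ha
      have := hm a x
      rw [← LinearMap.flip_apply m, ha, norm_zero, eq_comm, mul_eq_zero] at this
      exact norm_eq_zero.1 (this.resolve_right hx')
    obtain ⟨a, ha⟩ := LinearMap.injective_iff_surjective.1 hinj y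
    rw [LinearMap.flip_apply] at ha
    have ha1 : ‖a‖ = 1 := by
      have := hm a x
      rw [ha, ← hxy] at this
      exact mul_right_cancel₀ hx' (by rw [← this, one_mul])
    obtain ⟨g, hg⟩ := hL a ha1
    exact ⟨g, (hg x).trans ha⟩
  let : InnerProductSpace ℝ E := InnerProductSpace.ofNorm ℝ (parallelogram_of_transitive htrans)
  have : Nontrivial E := Module.nontrivial_of_finrank_eq_succ hdim
  obtain ⟨a, ha⟩ := exists_norm_eq E zero_le_one
  obtain ⟨L, hL⟩ := hL a ha
  obtain ⟨R, hR⟩ := hR a ha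
  let m' : E →ₗ[ℝ] E →ₗ[ℝ] E :=
    m.compl₁₂ (R.symm.toLinearEquiv : E →ₗ[ℝ] E) (L.symm.toLinearEquiv : E →ₗ[ℝ] E)
  have hm' (x y : E) : m' x y = m (R.symm x) (L.symm y) := rfl
  obtain ⟨Ψ, hΨ⟩ := exists_linearIsometryEquiv_quaternion hdim (m := m') (e := m a a)
    (fun x y => by rw [hm', hm, LinearIsometryEquiv.norm_map, LinearIsometryEquiv.norm_map])
    (fun x => by rw [hm', ← hR, LinearIsometryEquiv.symm_apply_apply, ← hL,
      LinearIsometryEquiv.apply_symm_apply])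
    (fun x => by rw [hm', ← hL, LinearIsometryEquiv.symm_apply_apply, ← hR,
      LinearIsometryEquiv.apply_symm_apply])
  refine ⟨Ψ.symm.toLinearEquiv, (Ψ.trans R).trans Ψ.symm, (Ψ.trans L).trans Ψ.symm, fun x y => ?_⟩
  change Ψ.symm (m x y) = Ψ.symm (R (Ψ (Ψ.symm x))) * Ψ.symm (L (Ψ (Ψ.symm y)))
  apply Ψ.injective
  simp [hΨ, hm']

theorem exists_linearEquiv_quaternion_of_isAbsoluteValuedNorm {A : Type*} [NonUnitalNonAssocRing A]
    [Module ℝ A] [IsScalarTower ℝ A A] [SMulCommClass ℝ A A]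
    {ν : Seminorm ℝ A} (hν : IsAbsoluteValuedNorm ν) (hdim : Module.finrank ℝ A = 4) :
    ∃ (Φ : A ≃ₗ[ℝ] ℍ) (φ ψ : ℍ ≃ₗᵢ[ℝ] ℍ), ∀ x y, Φ (x * y) = φ (Φ x) * ψ (Φ y) := by
  let : Norm A := ⟨ν⟩
  have core : NormedSpace.Core ℝ A :=
    { norm_nonneg x := apply_nonneg ν x
      norm_smul c x := map_smul_eq_mul ν c x
      norm_triangle x y := map_add_le_add ν x y
      norm_eq_zero_iff x := ⟨hν.eq_zero_of_map_eq_zero x, fun h => by rw [h]; exact map_zero ν⟩ }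
  let : NormedAddCommGroup A := NormedAddCommGroup.ofCore core
  let : NormedSpace ℝ A := NormedSpace.ofCore core
  exact exists_linearEquiv_quaternion_of_norm_mul (E := A) hdim (m := LinearMap.mul ℝ A)
    hν.map_mul

/-- Left multiplication by a unit quaternion. -/
noncomputable def unitMulLeft (a : ℍ) (ha : a * star a = 1) : ℍ ≃ₗ[ℝ] ℍ where
  toFun x := a * x
  invFun x := star a * x
  map_add' := mul_add a
  map_smul' c x := mul_smul_comm c a x
  left_inv x := by change star a * (a * x) = x; rw [← mul_assoc, mul_eq_one_comm.1 ha, one_mul]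
  right_inv x := by change a * (star a * x) = x; rw [← mul_assoc, ha, one_mul]

/-- Right multiplication by a unit quaternion. -/
noncomputable def unitMulRight (a : ℍ) (ha : a * star a = 1) : ℍ ≃ₗ[ℝ] ℍ where
  toFun x := x * a
  invFun x := x * star a
  map_add' x y := add_mul x y a
  map_smul' c x := smul_mul_assoc c x a
  left_inv x := by change x * a * star a = x; rw [mul_assoc, ha, mul_one]
  right_inv x := by change x * star a * a = x; rw [mul_assoc, mul_eq_one_comm.1 ha, mul_one]

section NormalForm

variable {A : Type*} [NonUnitalNonAssocRing A] [Module ℝ A]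

/-- The four families of absolute-valued algebras of dimension four: up to isomorphism, the
product is `u x y s`, `u x̄ ȳ s`, `u x s ȳ` or `x̄ s y u` with unit quaternions `u`, `s`. -/
theorem exists_normal_form {Φ : A ≃ₗ[ℝ] ℍ} {φ ψ : ℍ ≃ₗᵢ[ℝ] ℍ}
    (h : ∀ x y, Φ (x * y) = φ (Φ x) * ψ (Φ y)) :
    ∃ (F : A ≃ₗ[ℝ] ℍ) (u s : ℍ), u * star u = 1 ∧ s * star s = 1 ∧
      ((∀ x y, F (x * y) = u * F x * F y * s) ∨
        (∀ x y, F (x * y) = u * star (F x) * star (F y) * s) ∨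
        (∀ x y, F (x * y) = u * F x * s * star (F y)) ∨
        ∀ x y, F (x * y) = star (F x) * s * F y * u) := by
  obtain ⟨p, q, hp, hq, hφ⟩ := exists_eq_mul_mul_of_isometry φ
  obtain ⟨r, s, hr, hs, hψ⟩ := exists_eq_mul_mul_of_isometry ψ
  have hm := mul_mul_star_mul_eq_one hq hr
  have star_unit {a : ℍ} (ha : a * star a = 1) : star a * star (star a) = 1 := by
    rw [star_star]; exact mul_eq_one_comm.1 ha
  have cancel {a : ℍ} (ha : a * star a = 1) (x : ℍ) : a * (star a * x) = x := by
    rw [← mul_assoc, ha, one_mul]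
  have cancel' {a : ℍ} (ha : a * star a = 1) (x : ℍ) : star a * (a * x) = x := by
    rw [← mul_assoc, mul_eq_one_comm.1 ha, one_mul]
  -- In each case the parameters other than `u` and `s` are absorbed into `F`, a multiple of `Φ`
  -- by a unit quaternion on the left or on the right.
  rcases hφ with hφ | hφ <;> rcases hψ with hψ | hψ
  · refine ⟨Φ.trans (unitMulLeft _ hm), q * r * p * star (q * r), s,
      mul_mul_star_mul_eq_one (mul_mul_star_mul_eq_one hm hp) (star_unit hm), hs,
      Or.inl fun x y => ?_⟩
    change q * r * Φ (x * y) = _ * (q * r * Φ x) * (q * r * Φ y) * s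
    rw [h, hφ, hψ]
    simp only [mul_assoc, star_mul, cancel' hq, cancel' hr]
  · refine ⟨Φ.trans (unitMulRight _ (star_unit hs)), p, s * q * r * star s, hp,
      mul_mul_star_mul_eq_one (mul_mul_star_mul_eq_one (mul_mul_star_mul_eq_one hs hq) hr)
        (star_unit hs), Or.inr (Or.inr (Or.inl fun x y => ?_))⟩
    change Φ (x * y) * star s = p * (Φ x * star s) * _ * star (Φ y * star s)
    rw [h, hφ, hψ]
    simp only [mul_assoc, star_mul, star_star, cancel' hs, hs, mul_one]
  · refine ⟨Φ.trans (unitMulLeft _ (star_unit hp)), s, star p * q * r * p, hs,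
      mul_mul_star_mul_eq_one (mul_mul_star_mul_eq_one (mul_mul_star_mul_eq_one (star_unit hp) hq)
        hr) hp, Or.inr (Or.inr (Or.inr fun x y => ?_))⟩
    change star p * Φ (x * y) = star (star p * Φ x) * _ * (star p * Φ y) * s
    rw [h, hφ, hψ]
    simp only [mul_assoc, star_mul, star_star, cancel hp, cancel' hp]
  · refine ⟨Φ.trans (unitMulLeft _ (star_unit hm)), star (q * r) * p, star (q * r) * s,
      mul_mul_star_mul_eq_one (star_unit hm) hp, mul_mul_star_mul_eq_one (star_unit hm) hs,
      Or.inr (Or.inl fun x y => ?_)⟩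
    change star (q * r) * Φ (x * y) =
      _ * star (star (q * r) * Φ x) * star (star (q * r) * Φ y) * _
    rw [h, hφ, hψ]
    simp only [mul_assoc, star_mul, star_star, cancel hq, cancel hr]

/-- A linear isomorphism that is multiplicative up to the sign `-1` becomes multiplicative after
being replaced by its opposite. -/
theorem areIsomorphicAlgebras_of_map_mul_or_neg {B : Type*} [NonUnitalNonAssocRing B] [Module ℝ B]
    (F : A ≃ₗ[ℝ] B)
    (h : (∀ x y, F (x * y) = F x * F y) ∨ ∀ x y, F (x * y) = -(F x * F y)) :
    AreIsomorphicAlgebras A B := by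
  rcases h with h | h
  · exact ⟨{ F.toLinearMap with map_mul' := h, map_zero' := map_zero F }, F.bijective⟩
  · let G : A ≃ₗ[ℝ] B := F.trans (LinearEquiv.neg ℝ)
    have hG (x) : G x = -F x := rfl
    exact ⟨{ G.toLinearMap with
      map_mul' := fun x y => show G (x * y) = G x * G y by simp [hG, h]
      map_zero' := map_zero G }, G.bijective⟩

theorem IsFlexibleAlgebra.of_areIsomorphicAlgebras {B : Type*} [NonUnitalNonAssocRing B]
    [Module ℝ B] (hB : IsFlexibleAlgebra B) (h : AreIsomorphicAlgebras A B) :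
    IsFlexibleAlgebra A := by
  obtain ⟨φ, hφ⟩ := h
  intro x y
  apply hφ.injective
  have := hB (φ x) (φ y)
  simpa [associator_apply] using this

theorem isFlexibleAlgebra_quaternion : IsFlexibleAlgebra ℍ := fun x y => by
  simp [associator_apply, mul_assoc]

theorem isFlexibleAlgebra_doubleStarQuaternion : IsFlexibleAlgebra DoubleStarQuaternion := by
  intro x y
  apply DoubleStarQuaternion.toQuaternion.injective
  simp only [associator_apply, DoubleStarQuaternion.mul_def, LinearEquiv.apply_symm_apply, map_sub,
    map_zero, star_mul, star_star]
  rw [mul_assoc, Quaternion.self_mul_star, ← mul_assoc, Quaternion.star_mul_self,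
    Quaternion.coe_commutes, sub_self]

theorem mul_eq_mul_swap_of_star {x y : ℍ} (h : y * star x = star x * y) : y * x = x * y := by
  rwa [Quaternion.star_eq_two_re_sub, mul_sub, sub_mul, Quaternion.coe_commutes,
    sub_right_inj] at h

/-- Either of the two associator identities forces the parameters `u`, `s` of the first two
families to be `1` or `-1`, and excludes the other two families. -/
theorem areIsomorphicAlgebras_of_forms {F : A ≃ₗ[ℝ] ℍ} {u s : ℍ} (hu : u * star u = 1)
    (hs : s * star s = 1)
    (h : (∀ x y, F (x * y) = u * F x * F y * s) ∨
      (∀ x y, F (x * y) = u * star (F x) * star (F y) * s) ∨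
      (∀ x y, F (x * y) = u * F x * s * star (F y)) ∨
      ∀ x y, F (x * y) = star (F x) * s * F y * u)
    (hA : IsThirdPowerAssociative A ∨ ∀ x : A, associator x (x * x) x = 0) :
    AreIsomorphicAlgebras A ℍ ∨ AreIsomorphicAlgebras A DoubleStarQuaternion := by
  have hu0 : u ≠ 0 := left_ne_zero_of_mul_eq_one hu
  have hs0 : s ≠ 0 := left_ne_zero_of_mul_eq_one hs
  have key : (∀ z, F (F.symm z * F.symm z * F.symm z) = F (F.symm z * (F.symm z * F.symm z))) ∨
      ∀ z, F (F.symm z * (F.symm z * F.symm z) * F.symm z) =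
        F (F.symm z * (F.symm z * F.symm z * F.symm z)) :=
    hA.imp (fun hA z => congrArg F (sub_eq_zero.1 (hA (F.symm z))))
      (fun hA z => congrArg F (sub_eq_zero.1 (hA (F.symm z))))
  rcases h with h | h | h | h <;>
    simp only [h, LinearEquiv.apply_symm_apply] at key
  · left
    obtain ⟨hu', hs'⟩ : (u = 1 ∨ u = -1) ∧ (s = 1 ∨ s = -1) := by
      rcases key with key | key
      · refine eq_one_or_of_mul_sq_mul_commute hu hs fun z => ?_
        apply mul_left_cancel₀ hu0
        apply mul_right_cancel₀ hs0
        simpa only [mul_assoc] using key z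
      · refine eq_one_or_of_mul_isotope hu hs fun z => ?_
        apply mul_left_cancel₀ hu0
        apply mul_right_cancel₀ hs0
        simpa only [mul_assoc] using key z
    apply areIsomorphicAlgebras_of_map_mul_or_neg F
    rcases hu' with rfl | rfl <;> rcases hs' with rfl | rfl <;> simp [h]
  · right
    obtain ⟨hu', hs'⟩ : (u = 1 ∨ u = -1) ∧ (s = 1 ∨ s = -1) := by
      rcases key with key | key
      · refine eq_one_or_of_mul_sq_mul_commute hu hs fun z => mul_eq_mul_swap_of_star ?_
        have h1 := congrArg star (key (star z))
        apply mul_left_cancel₀ (star_ne_zero.2 hs0)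
        apply mul_right_cancel₀ (star_ne_zero.2 hu0)
        simpa only [mul_assoc, star_mul, star_star] using h1.symm
      · refine eq_one_or_of_star_mul_star_isotope hu hs fun z => ?_
        apply mul_left_cancel₀ hu0
        apply mul_right_cancel₀ hs0
        simpa only [mul_assoc, star_mul, star_star] using key z
    apply areIsomorphicAlgebras_of_map_mul_or_neg
      (F.trans DoubleStarQuaternion.toQuaternion.symm)
    simp only [DoubleStarQuaternion.mul_def, LinearEquiv.trans_apply,
      LinearEquiv.apply_symm_apply, ← map_neg, EmbeddingLike.apply_eq_iff_eq]
    rcases hu' with rfl | rfl <;> rcases hs' with rfl | rfl <;> simp [h]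
  · exfalso
    rcases key with key | key
    · refine false_of_mul_star_isotope_cube hu hs fun z => ?_
      apply mul_left_cancel₀ hu0
      simpa only [mul_assoc, star_mul, star_star] using key z
    · refine false_of_mul_star_isotope_sq hu hs fun z => ?_
      apply mul_left_cancel₀ hu0
      simpa only [mul_assoc, star_mul, star_star] using key z
  · exfalso
    -- Conjugation is an anti-isomorphism of the fourth family onto the third, with parameters
    -- `ū` and `s̄`.
    have hu' : star u * star (star u) = 1 := by rw [star_star]; exact mul_eq_one_comm.1 hu
    have hs' : star s * star (star s) = 1 := by rw [star_star]; exact mul_eq_one_comm.1 hs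
    rcases key with key | key
    · refine false_of_mul_star_isotope_cube hu' hs' fun z => ?_
      apply mul_left_cancel₀ (star_ne_zero.2 hu0)
      simpa only [mul_assoc, star_mul, star_star] using congrArg star (key (star z)).symm
    · refine false_of_mul_star_isotope_sq hu' hs' fun z => ?_
      apply mul_left_cancel₀ (star_ne_zero.2 hu0)
      simpa only [mul_assoc, star_mul, star_star] using congrArg star (key (star z)).symm

end NormalForm

theorem theorem3p12 {A : Type*} [NonUnitalNonAssocRing A] [Module ℝ A]
    [IsScalarTower ℝ A A] [SMulCommClass ℝ A A]
    (ν : Seminorm ℝ A) (hν : IsAbsoluteValuedNorm ν) (hdim : Module.finrank ℝ A = 4) :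
    List.TFAE [
      IsFlexibleAlgebra A,
      IsThirdPowerAssociative A,
      ∀ x : A, associator x (x * x) x = 0,
      AreIsomorphicAlgebras A ℍ ∨ AreIsomorphicAlgebras A DoubleStarQuaternion] := by
  obtain ⟨Φ, φ, ψ, h⟩ := exists_linearEquiv_quaternion_of_isAbsoluteValuedNorm hν hdim
  obtain ⟨F, u, s, hu, hs, hF⟩ := exists_normal_form h
  tfae_have 1 → 2 := fun h x => h x x
  tfae_have 1 → 3 := fun h x => h x (x * x)
  tfae_have 2 → 4 := fun h => areIsomorphicAlgebras_of_forms hu hs hF (Or.inl h)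
  tfae_have 3 → 4 := fun h => areIsomorphicAlgebras_of_forms hu hs hF (Or.inr h)
  tfae_have 4 → 1 := by
    rintro (h | h)
    · exact isFlexibleAlgebra_quaternion.of_areIsomorphicAlgebras h
    · exact isFlexibleAlgebra_doubleStarQuaternion.of_areIsomorphicAlgebras h
  tfae_finish
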